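/- Let $\gamma_0\subset\mathbb C$ be the L-shaped arc $$\gamma_0=\{(-1+i)x:\ 0\le x\le 27^{1/4}/\sqrt2\}\cup\{(-1-i)x:\ 0\le x\le 27^{1/4}/\sqrt2\},$$ let $$\psi_0(w)=\Big(w-\frac1w\Big)\Big(\frac{w-1}{w+1}\Big)^{1/2}$$ (principal square root) be the exterior conformal map of $\{|w|>1\}$ onto $\mathbb C\setminus\gamma_0$, extended continuously to $|w|=1$, and let $\Gamma_n=\{\psi_0(w):|w|=1+\frac1{n+1}\}$. For $0\le k\le\lfloor n/2\rfloor$ put $\theta_{n,k}=\frac{2k\pi}{n+1}$ if $n$ is even and $\theta_{n,k}=\frac{(2k+1)\pi}{n+1}$ if $n$ is odd, and for $\lfloor n/2\rfloor<k\le n$ put $\theta_{n,k}=-\theta_{n,2\lfloor n/2\rfloor+1-k}$. Let $z^*_{n,k}=\psi_0(e^{i\theta_{n,k}})$, $k=0,\dots,n$, be the Fejér points on $\gamma_0$, and let $\Pi_n$ be the space of complex polynomials of degree at most $n$. Then for every $1<p<\infty$ $$\limsup_{n\to\infty}\ \max_{P_n\in\Pi_n,\ P_n\ne0}\ \frac{\int_{\gamma_0}|P_n(z)|^p\,|dz|}{\sum_{k=0}^n|P_n(z^*_{n,k})|^p\,\mathrm{dist}(z^*_{n,k},\Gamma_n)}=\infty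 ,$$ where the quotient takes values in $[0,\infty]$ (it is $\infty$ if the denominator vanishes) and the maximum is attained for every $n$. Consequently the modified Marcinkiewicz–Zygmund inequalities fail for the Fejér points on $\gamma_0$: for no $1<p<\infty$ are there constants $0<c_1\le c_2$ such that $$c_1\sum_{k=0}^n|P_n(z^*_{n,k})|^p\,\mathrm{dist}(z^*_{n,k},\Gamma_n)\le\int_{\gamma_0}|P_n(z)|^p\,|dz|\le c_2\sum_{k=0}^n|P_n(z^*_{n,k})|^p\,\mathrm{dist}(z^*_{n,k},\Gamma_n)$$ for all $n\ge1$ and all $P_n\in\Pi_n$. -/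

import Mathlib

open Filter
open scoped ENNReal

noncomputable section

namespace LArc

/-- The parameter length `27^{1/4} / √2` of each of the two segments of the arc `γ₀`. -/
def halfLen : ℝ := (27 : ℝ) ^ (1 / 4 : ℝ) / Real.sqrt 2

/-- The upper segment of `γ₀`, parametrized by `x ∈ [0, halfLen]`. -/
def upperSeg (x : ℝ) : ℂ := (-1 + Complex.I) * x

/-- The lower segment of `γ₀`, parametrized by `x ∈ [0, halfLen]`. -/
def lowerSeg (x : ℝ) : ℂ := (-1 - Complex.I) * x

/-- The integral with respect to arc length, `∫ f(z) |dz|`, along the curve `c : [a, b] → ℂ`. -/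
def arcIntegral (c : ℝ → ℂ) (a b : ℝ) (f : ℂ → ℝ) : ℝ :=
  ∫ t in a..b, f (c t) * ‖deriv c t‖

/-- `∫_{γ₀} f(z) |dz|`, where `γ₀` is the union of the segments
`{(-1 + i) x : 0 ≤ x ≤ halfLen}` and `{(-1 - i) x : 0 ≤ x ≤ halfLen}`, which meet only at `0`. -/
def gammaIntegral (f : ℂ → ℝ) : ℝ :=
  arcIntegral upperSeg 0 halfLen f + arcIntegral lowerSeg 0 halfLen f

/-- The exterior conformal map `ψ₀(w) = (w - 1/w) ((w - 1)/(w + 1))^{1/2}`.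
For `|w| > 1` the number `(w - 1)/(w + 1)` has positive real part, for `|w| = 1`, `w ≠ ±1`, it is
purely imaginary and nonzero, so the principal square root is the holomorphic branch with
`ψ₀'(∞) > 0` and its continuous boundary extension; at `w = ±1` the value is `0`, which is
the boundary limit there. -/
def psi (w : ℂ) : ℂ := (w - 1 / w) * ((w - 1) / (w + 1)) ^ (1 / 2 : ℂ)

/-- The level curve `Γₙ = {ψ₀(w) : |w| = 1 + 1/(n+1)}`. -/
def levelCurve (n : ℕ) : Set ℂ := psi '' Metric.sphere (0 : ℂ) (1 + 1 / ((n : ℝ) + 1))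

/-- The angles `θ_{n,k}` for `0 ≤ k ≤ ⌊n/2⌋`. -/
def upperAngle (n k : ℕ) : ℝ :=
  if Even n then 2 * (k : ℝ) * Real.pi / ((n : ℝ) + 1)
  else (2 * (k : ℝ) + 1) * Real.pi / ((n : ℝ) + 1)

/-- The angles `θ_{n,k}` for `0 ≤ k ≤ n`. (The natural-number subtraction does not truncate
for `k ≤ n`.) -/
def angle (n k : ℕ) : ℝ :=
  if k ≤ n / 2 then upperAngle n k else -upperAngle n (2 * (n / 2) + 1 - k)

/-- The Fejér points `z*_{n,k} = ψ₀(e^{i θ_{n,k}})`, `0 ≤ k ≤ n`, on `γ₀`. -/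
def fejer (n k : ℕ) : ℂ := psi (Complex.exp (Complex.I * (angle n k : ℂ)))

/-- The integral `∫_{γ₀} |P(z)|^p |dz|`. -/
def contMean (p : ℝ) (P : Polynomial ℂ) : ℝ := gammaIntegral fun z => ‖P.eval z‖ ^ p

/-- The discrete sum `∑_{k=0}^n |P(z_{n,k})|^p dist(z_{n,k}, Γₙ)` for a family `z` of nodes. -/
def discMean (z : ℕ → ℕ → ℂ) (p : ℝ) (n : ℕ) (P : Polynomial ℂ) : ℝ :=
  ∑ k ∈ Finset.range (n + 1),
    ‖P.eval (z n k)‖ ^ p * Metric.infDist (z n k) (levelCurve n)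

/-- The ratio of the two, in `[0, ∞]`, with `a / 0 = ∞` for `a > 0`. (For `P = 0` it is
`0 / 0 = 0`, so that the zero polynomial does not influence suprema.) -/
def ratio (z : ℕ → ℕ → ℂ) (p : ℝ) (n : ℕ) (P : Polynomial ℂ) : ℝ≥0∞ :=
  ENNReal.ofReal (contMean p P) / ENNReal.ofReal (discMean z p n P)

/-- The supremum of the ratio over the polynomials of degree at most `n`. -/
def supRatio (z : ℕ → ℕ → ℂ) (p : ℝ) (n : ℕ) : ℝ≥0∞ :=
  ⨆ (P : Polynomial ℂ) (_ : P.natDegree ≤ n), ratio z p n P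

/-- The modified Marcinkiewicz–Zygmund inequalities on `γ₀` with exponent `p`, for the
family `z` of nodes. -/
def ModifiedMZ (z : ℕ → ℕ → ℂ) (p : ℝ) : Prop :=
  ∃ c₁ c₂ : ℝ, 0 < c₁ ∧ c₁ ≤ c₂ ∧ ∀ n : ℕ, 1 ≤ n → ∀ P : Polynomial ℂ, P.natDegree ≤ n →
    c₁ * discMean z p n P ≤ contMean p P ∧ contMean p P ≤ c₂ * discMean z p n P

end LArc

end

namespace LArc

/-! ### Bernstein–Walsh and Markov inequalities, and a lower bound for `L^p` norms of polynomials.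
-/

section Polynomial

open Polynomial

/-! The failure comes from two Fejér points that lie too close together. The boundary map folds the
circle at `e^{2πi/3}`, the preimage of the upper tip. For `n = 6m + 2` the tip is itself a node, and
its two neighbours have angles `2π/3 ± δ` with `δ = 2π/(n+1)`. On the segment the even-order terms
in `δ` cancel between the two images, so these lie only `O(δ³) = O(n⁻³)` apart
(`abs_segParam_sub_le`), whereas a polynomial of degree `n` varies on the scale `n⁻²` of Markov's
inequality.

Let `P` be the nodal polynomial with the node at `2π/3 + δ` left out, and let `M` be the maximum of
`|P|` on the upper segment. As `P` vanishes at the twin node, Markov's inequality gives `|P| = O(n²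
· n⁻³ · M) = O(M/n)` at the omitted node. The discrete sum has only this term, whose weight is
`O(1/n)` (`exists_infDist_levelCurve_le`). Markov also gives `|P| ≥ M/2` on an interval of length of
order `n⁻²`, so the integral is at least of order `n⁻² M^p` (`le_intervalIntegral_norm_rpow`). The
quotient therefore grows at least like `n^{p-1}`; `mul_discMean_le_contMean` combines these bounds.

That the maximum is attained is compactness of the unit sphere of coefficient vectors together with
homogeneity. -/

theorem exists_joukowski (z : ℂ) : ∃ w : ℂ, w ≠ 0 ∧ ‖w‖ ≤ 1 ∧ z = (w + w⁻¹) / 2 := by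
  obtain ⟨s, hs⟩ := IsAlgClosed.exists_pow_nat_eq (z ^ 2 - 1) (n := 2) two_pos
  have hprod : (z + s) * (z - s) = 1 := by linear_combination -hs
  have h1 : z + s ≠ 0 := left_ne_zero_of_mul_eq_one hprod
  have h2 : z - s ≠ 0 := right_ne_zero_of_mul_eq_one hprod
  have hinv : (z + s)⁻¹ = z - s := inv_eq_of_mul_eq_one_right hprod
  rcases le_total ‖z + s‖ 1 with h | h
  · exact ⟨z + s, h1, h, by rw [hinv]; ring⟩
  · refine ⟨z - s, h2, ?_, by rw [← hinv, inv_inv]; rw [hinv]; ring⟩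
    rw [← hinv, norm_inv]
    exact inv_le_one_of_one_le₀ h

/-- Circles about `0` go to ellipses with foci `±1`: both distances are `|w ∓ 1|² / (2|w|)`, and the
parallelogram law adds them. -/
theorem norm_joukowski_sub_add {w : ℂ} (hw : w ≠ 0) :
    ‖(w + w⁻¹) / 2 - 1‖ + ‖(w + w⁻¹) / 2 + 1‖ = ‖w‖ + ‖w‖⁻¹ := by
  have hw' : ‖w‖ ≠ 0 := norm_ne_zero_iff.mpr hw
  have e1 : (w + w⁻¹) / 2 - 1 = (w - 1) ^ 2 / (2 * w) := by field_simp; ring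
  have e2 : (w + w⁻¹) / 2 + 1 = (w + 1) ^ 2 / (2 * w) := by field_simp; ring
  have h := parallelogram_law_with_norm ℝ w 1
  rw [norm_one] at h
  rw [e1, e2, norm_div, norm_div, norm_pow, norm_pow, norm_mul, Complex.norm_ofNat, ← add_div,
    div_eq_iff (by positivity)]
  field_simp
  nlinarith

theorem pow_inv_le_exp_three {n : ℕ} (hn : 1 ≤ n) {r : ℝ} (hr : 0 < r) (hr1 : r ≤ 1)
    (h : r + r⁻¹ ≤ 2 + 2 / (n : ℝ) ^ 2) : r⁻¹ ^ n ≤ Real.exp 3 := by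
  have hn' : (1 : ℝ) ≤ n := by exact_mod_cast hn
  set a : ℝ := 1 / n with ha
  have ha0 : 0 < a := by positivity
  have ha1 : a ≤ 1 := by rw [ha, div_le_one (by positivity)]; exact hn'
  have h2 : r + r⁻¹ ≤ 2 + 2 * a ^ 2 := by
    rw [ha, div_pow, one_pow]; convert h using 2; ring
  set q := r⁻¹ with hq
  have hqr : q * r = 1 := inv_mul_cancel₀ hr.ne'
  have hq1 : 1 ≤ q := (one_le_inv₀ hr).mpr hr1
  have hq4 : q ≤ 4 := by nlinarith
  -- Since `(q - 1)² = q (r + q - 2) ≤ 4 · 2a²`, the constant `3` is `√8` rounded up.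
  have hsq : (q - 1) ^ 2 ≤ (3 * a) ^ 2 := by
    have : (q - 1) ^ 2 = q * (r + q - 2) := by linear_combination -hqr
    rw [this]
    nlinarith [mul_nonneg (by linarith : (0 : ℝ) ≤ q) (by linarith : 0 ≤ 2 + 2 * a ^ 2 - (r + q)),
      mul_nonneg (by linarith : (0 : ℝ) ≤ 4 - q) (sq_nonneg a)]
  have hle : q ≤ 3 * a + 1 := by
    have := abs_le_of_sq_le_sq' hsq (by positivity)
    linarith [this.2]
  calc q ^ n ≤ Real.exp (3 * a) ^ n := by
        gcongr
        exact hle.trans (Real.add_one_le_exp _)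
    _ = Real.exp 3 := by
        rw [← Real.exp_nat_mul, ha]
        congr 1
        field_simp

/-- A Bernstein–Walsh inequality for the interval `[-1, 1]`. -/
theorem norm_eval_le_of_norm_sub_add_norm_add_le {n : ℕ} (hn : 1 ≤ n) {Q : ℂ[X]}
    (hQ : Q.natDegree ≤ n) {M : ℝ} (hM : ∀ x ∈ Set.Icc (-1 : ℝ) 1, ‖Q.eval (x : ℂ)‖ ≤ M) {z : ℂ}
    (hz : ‖z - 1‖ + ‖z + 1‖ ≤ 2 + 2 / (n : ℝ) ^ 2) : ‖Q.eval z‖ ≤ Real.exp 3 * M := by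
  have hM0 : 0 ≤ M := (norm_nonneg _).trans (hM 0 (by norm_num))
  -- `w ^ n * Q((w + w⁻¹)/2)` with the singularity at `0` removed, so that the maximum principle
  -- applies on the whole unit disc. On the unit circle `(w + w⁻¹)/2` is real and lies in `[-1, 1]`.
  let R : ℂ → ℂ := fun w =>
    ∑ m ∈ Finset.range (n + 1), Q.coeff m * (w ^ (n - m) * ((w ^ 2 + 1) / 2) ^ m)
  have hR : ∀ w : ℂ, w ≠ 0 → R w = w ^ n * Q.eval ((w + w⁻¹) / 2) := by
    intro w hw
    rw [Polynomial.eval_eq_sum_range' (Nat.lt_succ_of_le hQ), Finset.mul_sum]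
    refine Finset.sum_congr rfl fun m hm => ?_
    have hm' : m ≤ n := Nat.lt_succ_iff.mp (Finset.mem_range.mp hm)
    have : (w ^ 2 + 1) / 2 = w * ((w + w⁻¹) / 2) := by field_simp
    rw [this, mul_pow, ← mul_assoc (w ^ (n - m)), ← pow_add, Nat.sub_add_cancel hm']
    ring
  have hRd : Differentiable ℂ R := by
    intro w
    fun_prop
  have hball : ∀ w : ℂ, ‖w‖ ≤ 1 → ‖R w‖ ≤ M := by
    intro w hw
    refine Complex.norm_le_of_forall_mem_frontier_norm_le (U := Metric.ball 0 1)
      Metric.isBounded_ball hRd.diffContOnCl ?_ ?_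
    · intro v hv
      rw [frontier_ball _ one_ne_zero, mem_sphere_zero_iff_norm] at hv
      have hv0 : v ≠ 0 := norm_ne_zero_iff.mp (by rw [hv]; exact one_ne_zero)
      have hre : (v + v⁻¹) / 2 = (v.re : ℂ) := by
        rw [Complex.inv_eq_conj hv, Complex.re_eq_add_conj]
      rw [hR v hv0, hre, norm_mul, norm_pow, hv, one_pow, one_mul]
      exact hM _ (abs_le.mp ((Complex.abs_re_le_norm v).trans hv.le))
    · rw [closure_ball _ one_ne_zero, mem_closedBall_zero_iff]
      exact hw
  obtain ⟨w, hw0, hw1, rfl⟩ := exists_joukowski z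
  rw [norm_joukowski_sub_add hw0] at hz
  have hpos : 0 < ‖w‖ := norm_pos_iff.mpr hw0
  have hexp := pow_inv_le_exp_three hn hpos hw1 hz
  have h1 := hball w hw1
  rw [hR w hw0, norm_mul, norm_pow] at h1
  calc ‖Q.eval ((w + w⁻¹) / 2)‖ = ‖w‖⁻¹ ^ n * (‖w‖ ^ n * ‖Q.eval ((w + w⁻¹) / 2)‖) := by
        rw [← mul_assoc, ← mul_pow, inv_mul_cancel₀ hpos.ne', one_pow, one_mul]
    _ ≤ Real.exp 3 * M := by gcongr

/-- A Markov inequality on `[-1, 1]`, with a non-optimal constant. -/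
theorem norm_eval_derivative_le {n : ℕ} (hn : 1 ≤ n) {Q : ℂ[X]} (hQ : Q.natDegree ≤ n) {M : ℝ}
    (hM : ∀ x ∈ Set.Icc (-1 : ℝ) 1, ‖Q.eval (x : ℂ)‖ ≤ M) {x : ℝ} (hx : x ∈ Set.Icc (-1 : ℝ) 1) :
    ‖Q.derivative.eval (x : ℂ)‖ ≤ Real.exp 3 * (n : ℝ) ^ 2 * M := by
  have hn' : (0 : ℝ) < n := by exact_mod_cast hn
  -- Cauchy's estimate: the circle of radius `1/n²` about a point of `[-1, 1]` stays inside the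
  -- ellipse of the Bernstein–Walsh bound.
  have h := Complex.norm_deriv_le_of_forall_mem_sphere_norm_le (c := (x : ℂ))
    (f := fun z => Q.eval z) (R := 1 / (n : ℝ) ^ 2) (C := Real.exp 3 * M) (by positivity)
    Q.differentiable.diffContOnCl ?_
  · rw [Polynomial.deriv] at h
    refine h.trans (le_of_eq ?_)
    field_simp
  · intro z hz
    refine norm_eval_le_of_norm_sub_add_norm_add_le hn hQ hM ?_
    rw [mem_sphere_iff_norm] at hz
    have h1 : ‖(x : ℂ) - 1‖ = 1 - x := by
      rw [← Complex.ofReal_one, ← Complex.ofReal_sub, Complex.norm_real, Real.norm_eq_abs,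
        abs_of_nonpos (by linarith [hx.2])]
      ring
    have h2 : ‖(x : ℂ) + 1‖ = x + 1 := by
      rw [← Complex.ofReal_one, ← Complex.ofReal_add, Complex.norm_real, Real.norm_eq_abs,
        abs_of_nonneg (by linarith [hx.1])]
    have h3 : ‖z - 1‖ ≤ ‖z - x‖ + ‖(x : ℂ) - 1‖ := norm_sub_le_norm_sub_add_norm_sub z x 1
    have h4 : ‖z + 1‖ ≤ ‖z - x‖ + ‖(x : ℂ) + 1‖ := by
      calc ‖z + 1‖ = ‖(z - x) + ((x : ℂ) + 1)‖ := by ring_nf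
        _ ≤ _ := norm_add_le _ _
    rw [hz, h1] at h3
    rw [hz, h2] at h4
    have : (2 : ℝ) / (n : ℝ) ^ 2 = 1 / (n : ℝ) ^ 2 + 1 / (n : ℝ) ^ 2 := by ring
    linarith

/-- The Markov inequality on `[0, L]`. -/
theorem norm_eval_derivative_le_of_Icc {n : ℕ} (hn : 1 ≤ n) {Q : ℂ[X]} (hQ : Q.natDegree ≤ n)
    {L M : ℝ} (hL : 0 < L) (hM : ∀ x ∈ Set.Icc 0 L, ‖Q.eval (x : ℂ)‖ ≤ M) {x : ℝ}
    (hx : x ∈ Set.Icc 0 L) :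
    ‖Q.derivative.eval (x : ℂ)‖ ≤ 2 / L * Real.exp 3 * (n : ℝ) ^ 2 * M := by
  let A : ℂ[X] := C (L / 2 : ℂ) * X + C (L / 2 : ℂ)
  have hA : ∀ y : ℝ, A.eval (y : ℂ) = ((L / 2 * y + L / 2 : ℝ) : ℂ) := by
    intro y; simp [A]
  have hdeg : (Q.comp A).natDegree ≤ n := by
    refine natDegree_comp_le.trans ?_
    have : A.natDegree ≤ 1 := natDegree_linear_le
    nlinarith
  have hxL : 2 / L * x - 1 ∈ Set.Icc (-1 : ℝ) 1 := by
    have : 2 / L * x ≤ 2 := by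
      rw [div_mul_eq_mul_div, div_le_iff₀ hL]; linarith [hx.2]
    have : 0 ≤ 2 / L * x := mul_nonneg (by positivity) hx.1
    constructor <;> linarith
  have h := norm_eval_derivative_le hn hdeg (M := M) (fun y hy => ?_) hxL
  · have hAx : A.eval ((2 / L * x - 1 : ℝ) : ℂ) = x := by
      rw [hA]; congr 1; field_simp; ring
    have hAd : A.derivative = C (L / 2 : ℂ) := by simp [A]
    rw [derivative_comp, eval_mul, eval_comp, hAx, hAd, eval_C, norm_mul] at h
    have hnorm : ‖(L / 2 : ℂ)‖ = L / 2 := by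
      rw [norm_div, Complex.norm_real, Complex.norm_ofNat, Real.norm_eq_abs, abs_of_pos hL]
    rw [hnorm] at h
    calc _ = 2 / L * (L / 2 * ‖Q.derivative.eval (x : ℂ)‖) := by field_simp
      _ ≤ 2 / L * (Real.exp 3 * (n : ℝ) ^ 2 * M) := by gcongr
      _ = _ := by ring
  · rw [eval_comp, hA]
    refine hM _ ⟨?_, ?_⟩ <;> nlinarith [hy.1, hy.2]

theorem norm_eval_sub_le_of_Icc {n : ℕ} (hn : 1 ≤ n) {Q : ℂ[X]} (hQ : Q.natDegree ≤ n)
    {L M : ℝ} (hL : 0 < L) (hM : ∀ x ∈ Set.Icc 0 L, ‖Q.eval (x : ℂ)‖ ≤ M) {x y : ℝ}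
    (hx : x ∈ Set.Icc 0 L) (hy : y ∈ Set.Icc 0 L) :
    ‖Q.eval (y : ℂ) - Q.eval (x : ℂ)‖ ≤ 2 / L * Real.exp 3 * (n : ℝ) ^ 2 * M * |y - x| :=
  Convex.norm_image_sub_le_of_norm_hasDerivWithin_le (f := fun t : ℝ => Q.eval (t : ℂ))
    (f' := fun t : ℝ => Q.derivative.eval (t : ℂ))
    (fun t _ => ((Q.hasDerivAt (t : ℂ)).comp_ofReal).hasDerivWithinAt)
    (fun _ ht => norm_eval_derivative_le_of_Icc hn hQ hL hM ht) (convex_Icc 0 L) hx hy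

/-- If `f` is `B M`-Lipschitz on `[0, L]`, where `M` is the maximum of `‖f‖`, then `M` is
controlled by the `L^p` norm of `f`. -/
theorem le_intervalIntegral_norm_rpow {f : ℝ → ℂ} (hf : Continuous f) {L B M p : ℝ} (hp : 0 < p)
    (hB : 0 < B) (hBL : 1 / (2 * B) ≤ L / 2) {x₀ : ℝ} (hx₀ : x₀ ∈ Set.Icc 0 L)
    (hM : ‖f x₀‖ = M) (hLip : ∀ x ∈ Set.Icc 0 L, ‖f x - f x₀‖ ≤ B * M * |x - x₀|) :
    1 / (2 * B) * (M / 2) ^ p ≤ ∫ t in (0 : ℝ)..L, ‖f t‖ ^ p := by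
  have hM0 : 0 ≤ M := hM ▸ norm_nonneg _
  set η := 1 / (2 * B) with hη
  have hη0 : 0 < η := by positivity
  have hcont : Continuous fun t => ‖f t‖ ^ p := hf.norm.rpow_const fun _ => Or.inr hp.le
  have hlow : ∀ x ∈ Set.Icc 0 L, |x - x₀| ≤ η → (M / 2) ^ p ≤ ‖f x‖ ^ p := by
    intro x hx hxη
    refine Real.rpow_le_rpow (by positivity) ?_ hp.le
    have h1 := hLip x hx
    have h2 : B * M * |x - x₀| ≤ M / 2 := by
      calc B * M * |x - x₀| ≤ B * M * η := by gcongr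
        _ = M / 2 := by rw [hη]; field_simp
    have h3 := norm_sub_norm_le (f x₀) (f x)
    rw [norm_sub_rev, hM] at h3
    linarith
  -- A one-sided interval of length `η` at `x₀` suffices. Because `η ≤ L/2`, it fits into `[0, L]`
  -- on the right or on the left of `x₀`.
  have key : ∀ a : ℝ, 0 ≤ a → a + η ≤ L → a ≤ x₀ → x₀ ≤ a + η →
      η * (M / 2) ^ p ≤ ∫ t in (0 : ℝ)..L, ‖f t‖ ^ p := by
    intro a ha haL h1 h2
    calc η * (M / 2) ^ p = ∫ _ in a..(a + η), (M / 2) ^ p := by simp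
      _ ≤ ∫ t in a..(a + η), ‖f t‖ ^ p := by
          refine intervalIntegral.integral_mono_on (by linarith) (by simp)
            (hcont.intervalIntegrable _ _) fun x hx => hlow x ⟨?_, ?_⟩ ?_
          · linarith [hx.1]
          · linarith [hx.2]
          · rw [abs_le]; constructor <;> linarith [hx.1, hx.2]
      _ ≤ ∫ t in (0 : ℝ)..L, ‖f t‖ ^ p := by
          refine intervalIntegral.integral_mono_interval ha (by linarith) haL ?_
            (hcont.intervalIntegrable _ _)
          exact Filter.Eventually.of_forall fun t => by positivity
  rcases le_total x₀ (L / 2) with h | h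
  · exact key x₀ hx₀.1 (by linarith) le_rfl (by linarith)
  · exact key (x₀ - η) (by linarith) (by linarith [hx₀.2]) (by linarith) (by linarith)

end Polynomial

/-! ### Positivity and homogeneity of the means, and existence of a maximizer. -/

section Attained

open Polynomial

theorem halfLen_pos : 0 < halfLen := by unfold halfLen; positivity

theorem hasDerivAt_upperSeg (t : ℝ) : HasDerivAt upperSeg (-1 + Complex.I) t := by
  have h := ((hasDerivAt_id t).ofReal_comp).const_mul (-1 + Complex.I)
  rw [Complex.ofReal_one, mul_one] at h
  exact h

theorem hasDerivAt_lowerSeg (t : ℝ) : HasDerivAt lowerSeg (-1 - Complex.I) t := by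
  have h := ((hasDerivAt_id t).ofReal_comp).const_mul (-1 - Complex.I)
  rw [Complex.ofReal_one, mul_one] at h
  exact h

theorem continuous_upperSeg : Continuous upperSeg := by unfold upperSeg; fun_prop

theorem continuous_lowerSeg : Continuous lowerSeg := by unfold lowerSeg; fun_prop

theorem norm_neg_one_add_I : ‖(-1 + Complex.I : ℂ)‖ = √2 := by
  rw [Complex.norm_def, Complex.normSq_apply]; norm_num

theorem arcIntegral_upperSeg (f : ℂ → ℝ) :
    arcIntegral upperSeg 0 halfLen f = ∫ t in (0 : ℝ)..halfLen, f (upperSeg t) * √2 := by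
  unfold arcIntegral
  simp only [(hasDerivAt_upperSeg _).deriv, norm_neg_one_add_I]

theorem arcIntegral_lowerSeg (f : ℂ → ℝ) :
    arcIntegral lowerSeg 0 halfLen f =
      ∫ t in (0 : ℝ)..halfLen, f (lowerSeg t) * ‖(-1 - Complex.I : ℂ)‖ := by
  unfold arcIntegral
  simp only [(hasDerivAt_lowerSeg _).deriv]

theorem intervalIntegral_upperSeg_le_contMean (p : ℝ) (hp : 0 < p) (P : ℂ[X]) :
    ∫ t in (0 : ℝ)..halfLen, ‖P.eval (upperSeg t)‖ ^ p ≤ contMean p P := by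
  have hlow : 0 ≤ arcIntegral lowerSeg 0 halfLen fun z => ‖P.eval z‖ ^ p :=
    intervalIntegral.integral_nonneg halfLen_pos.le fun t _ => by positivity
  have hc : Continuous fun t => ‖P.eval (upperSeg t)‖ ^ p :=
    (P.continuous.comp continuous_upperSeg).norm.rpow_const fun _ => Or.inr hp.le
  have h1 : (1 : ℝ) ≤ √2 := Real.one_le_sqrt.mpr one_le_two
  have hup : ∫ t in (0 : ℝ)..halfLen, ‖P.eval (upperSeg t)‖ ^ p ≤
      arcIntegral upperSeg 0 halfLen fun z => ‖P.eval z‖ ^ p := by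
    rw [arcIntegral_upperSeg]
    refine intervalIntegral.integral_mono_on halfLen_pos.le (hc.intervalIntegrable _ _)
      ((hc.mul_const _).intervalIntegrable _ _) fun t _ => le_mul_of_one_le_right (by positivity) h1
  unfold contMean gammaIntegral
  linarith

theorem contMean_pos {p : ℝ} (hp : 0 < p) {P : ℂ[X]} (hP : P ≠ 0) : 0 < contMean p P := by
  refine lt_of_lt_of_le ?_ (intervalIntegral_upperSeg_le_contMean p hp P)
  have hc : Continuous fun t => ‖P.eval (upperSeg t)‖ ^ p :=
    (P.continuous.comp continuous_upperSeg).norm.rpow_const fun _ => Or.inr hp.le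
  refine intervalIntegral.integral_pos halfLen_pos hc.continuousOn (fun t _ => by positivity) ?_
  by_contra! h
  have hroot : ∀ t ∈ Set.Icc (0 : ℝ) halfLen, upperSeg t ∈ P.rootSet ℂ := by
    intro t ht
    rw [mem_rootSet]
    refine ⟨hP, ?_⟩
    rw [coe_aeval_eq_eval]
    by_contra h0
    exact absurd (h t ht) (not_le.mpr (Real.rpow_pos_of_pos (norm_pos_iff.mpr h0) p))
  have hinj : Function.Injective upperSeg := by
    intro s t hst
    have hne : (-1 + Complex.I : ℂ) ≠ 0 := by
      rw [← norm_pos_iff, norm_neg_one_add_I]; positivity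
    exact_mod_cast mul_left_cancel₀ hne hst
  exact (Set.Icc_infinite halfLen_pos)
    (((P.rootSet_finite ℂ).preimage hinj.injOn).subset hroot)

theorem discMean_nonneg (z : ℕ → ℕ → ℂ) (p : ℝ) (n : ℕ) (P : ℂ[X]) : 0 ≤ discMean z p n P :=
  Finset.sum_nonneg fun _ _ => mul_nonneg (by positivity) Metric.infDist_nonneg

theorem gammaIntegral_const_mul (a : ℝ) (f : ℂ → ℝ) :
    gammaIntegral (fun z => a * f z) = a * gammaIntegral f := by
  unfold gammaIntegral arcIntegral
  simp only [mul_assoc, intervalIntegral.integral_const_mul, mul_add]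

theorem contMean_C_mul (p : ℝ) (a : ℂ) (P : ℂ[X]) :
    contMean p (C a * P) = ‖a‖ ^ p * contMean p P := by
  unfold contMean
  rw [← gammaIntegral_const_mul]
  simp only [eval_mul, eval_C, norm_mul, Real.mul_rpow (norm_nonneg _) (norm_nonneg _)]

theorem discMean_C_mul (z : ℕ → ℕ → ℂ) (p : ℝ) (n : ℕ) (a : ℂ) (P : ℂ[X]) :
    discMean z p n (C a * P) = ‖a‖ ^ p * discMean z p n P := by
  unfold discMean
  rw [Finset.mul_sum]
  simp only [eval_mul, eval_C, norm_mul, Real.mul_rpow (norm_nonneg _) (norm_nonneg _), mul_assoc]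

theorem ratio_C_mul (z : ℕ → ℕ → ℂ) (p : ℝ) (n : ℕ) {a : ℂ} (ha : a ≠ 0) (P : ℂ[X]) :
    ratio z p n (C a * P) = ratio z p n P := by
  have h : 0 < ‖a‖ ^ p := Real.rpow_pos_of_pos (norm_pos_iff.mpr ha) p
  unfold ratio
  rw [contMean_C_mul, discMean_C_mul, ENNReal.ofReal_mul h.le, ENNReal.ofReal_mul h.le]
  exact ENNReal.mul_div_mul_left _ _ (ENNReal.ofReal_pos.mpr h).ne' ENNReal.ofReal_ne_top

/-- The polynomial with the given coefficients. -/
noncomputable def ofCoeffs (n : ℕ) (c : Fin (n + 1) → ℂ) : ℂ[X] := ∑ i, C (c i) * X ^ (i : ℕ)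

theorem eval_ofCoeffs (n : ℕ) (c : Fin (n + 1) → ℂ) (z : ℂ) :
    (ofCoeffs n c).eval z = ∑ i, c i * z ^ (i : ℕ) := by
  simp [ofCoeffs, eval_finsetSum]

theorem natDegree_ofCoeffs_le (n : ℕ) (c : Fin (n + 1) → ℂ) : (ofCoeffs n c).natDegree ≤ n :=
  natDegree_sum_le_of_forall_le _ _ fun i _ =>
    (natDegree_C_mul_X_pow_le _ _).trans (Nat.lt_succ_iff.mp i.2)

theorem coeff_ofCoeffs (n : ℕ) (c : Fin (n + 1) → ℂ) (i : Fin (n + 1)) :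
    (ofCoeffs n c).coeff i = c i := by
  simp [ofCoeffs, coeff_X_pow, Fin.val_inj]

theorem ofCoeffs_ne_zero {n : ℕ} {c : Fin (n + 1) → ℂ} (hc : c ≠ 0) : ofCoeffs n c ≠ 0 := by
  intro h
  refine hc (funext fun i => ?_)
  rw [← coeff_ofCoeffs n c i, h, coeff_zero, Pi.zero_apply]

theorem ofCoeffs_coeff {n : ℕ} {P : ℂ[X]} (hP : P.natDegree ≤ n) :
    ofCoeffs n (fun i => P.coeff i) = P := by
  unfold ofCoeffs
  rw [Fin.sum_univ_eq_sum_range (fun i => C (P.coeff i) * X ^ i) (n + 1)]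
  exact (P.as_sum_range_C_mul_X_pow' (Nat.lt_succ_of_le hP)).symm

theorem ofCoeffs_smul (n : ℕ) (a : ℂ) (c : Fin (n + 1) → ℂ) :
    ofCoeffs n (a • c) = C a * ofCoeffs n c := by
  simp [ofCoeffs, Finset.mul_sum, mul_assoc]

theorem continuous_norm_eval_ofCoeffs_rpow (n : ℕ) {p : ℝ} (hp : 0 < p) {X : Type*}
    [TopologicalSpace X] {u : X → Fin (n + 1) → ℂ} (hu : Continuous u) {v : X → ℂ}
    (hv : Continuous v) : Continuous fun x => ‖(ofCoeffs n (u x)).eval (v x)‖ ^ p := by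
  refine Continuous.rpow_const (Continuous.norm ?_) fun _ => Or.inr hp.le
  simp only [eval_ofCoeffs]
  fun_prop

theorem continuous_contMean_ofCoeffs (n : ℕ) {p : ℝ} (hp : 0 < p) :
    Continuous fun c => contMean p (ofCoeffs n c) := by
  unfold contMean gammaIntegral
  simp only [arcIntegral_upperSeg, arcIntegral_lowerSeg]
  refine Continuous.add ?_ ?_ <;>
    refine intervalIntegral.continuous_parametric_intervalIntegral_of_continuous' ?_ _ _
  · exact (continuous_norm_eval_ofCoeffs_rpow n hp continuous_fst
      (continuous_upperSeg.comp continuous_snd)).mul_const _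
  · exact (continuous_norm_eval_ofCoeffs_rpow n hp continuous_fst
      (continuous_lowerSeg.comp continuous_snd)).mul_const _

theorem continuous_discMean_ofCoeffs (z : ℕ → ℕ → ℂ) (n : ℕ) {p : ℝ} (hp : 0 < p) :
    Continuous fun c => discMean z p n (ofCoeffs n c) :=
  continuous_finsetSum _ fun _ _ =>
    (continuous_norm_eval_ofCoeffs_rpow n hp continuous_id continuous_const).mul_const _

theorem ratio_le_supRatio (z : ℕ → ℕ → ℂ) (p : ℝ) {n : ℕ} {P : ℂ[X]} (hP : P.natDegree ≤ n) :
    ratio z p n P ≤ supRatio z p n :=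
  le_iSup₂_of_le P hP le_rfl

/-- The supremum of the ratio over the polynomials of degree at most `n` is attained. -/
theorem exists_ratio_eq_supRatio (z : ℕ → ℕ → ℂ) {p : ℝ} (hp : 0 < p) (n : ℕ) :
    ∃ P : ℂ[X], P ≠ 0 ∧ P.natDegree ≤ n ∧ ratio z p n P = supRatio z p n := by
  -- A nonzero `P` with vanishing denominator already has ratio `∞`. Otherwise the quotient is
  -- finite and continuous on the unit sphere of coefficients.
  by_cases hdeg : ∃ P : ℂ[X], P ≠ 0 ∧ P.natDegree ≤ n ∧ discMean z p n P = 0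
  · obtain ⟨P, hP0, hPn, hP⟩ := hdeg
    refine ⟨P, hP0, hPn, (ratio_le_supRatio z p hPn).antisymm ?_⟩
    have : ratio z p n P = ⊤ := by
      unfold ratio
      rw [hP, ENNReal.ofReal_zero]
      exact ENNReal.div_zero (ENNReal.ofReal_pos.mpr (contMean_pos hp hP0)).ne'
    rw [this]
    exact le_top
  · have hpos : ∀ P : ℂ[X], P ≠ 0 → P.natDegree ≤ n → 0 < discMean z p n P := fun P h0 hn =>
      (discMean_nonneg z p n P).lt_of_ne' fun h => hdeg ⟨P, h0, hn, h⟩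
    have hne : ∀ c ∈ Metric.sphere (0 : Fin (n + 1) → ℂ) 1, c ≠ 0 := fun c hc =>
      ne_zero_of_mem_unit_sphere (⟨c, hc⟩ : Metric.sphere (0 : Fin (n + 1) → ℂ) 1)
    obtain ⟨c, hc, hmax⟩ := (isCompact_sphere (0 : Fin (n + 1) → ℂ) 1).exists_isMaxOn
      (NormedSpace.sphere_nonempty.mpr zero_le_one)
      ((continuous_contMean_ofCoeffs n hp).continuousOn.div
        (continuous_discMean_ofCoeffs z n hp).continuousOn fun c hc =>
          (hpos _ (ofCoeffs_ne_zero (hne c hc)) (natDegree_ofCoeffs_le n c)).ne')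
    have hratio : ∀ c ∈ Metric.sphere (0 : Fin (n + 1) → ℂ) 1, ratio z p n (ofCoeffs n c) =
        ENNReal.ofReal (contMean p (ofCoeffs n c) / discMean z p n (ofCoeffs n c)) := fun c hc =>
      (ENNReal.ofReal_div_of_pos
        (hpos _ (ofCoeffs_ne_zero (hne c hc)) (natDegree_ofCoeffs_le n c))).symm
    refine ⟨ofCoeffs n c, ofCoeffs_ne_zero (hne c hc), natDegree_ofCoeffs_le n c,
      (ratio_le_supRatio z p (natDegree_ofCoeffs_le n c)).antisymm (iSup₂_le fun P hPn => ?_)⟩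
    by_cases hP : P = 0
    · have h0 : contMean p (0 : ℂ[X]) = 0 := by
        simpa [Real.zero_rpow hp.ne'] using contMean_C_mul p 0 (0 : ℂ[X])
      have : ratio z p n P = 0 := by
        unfold ratio
        rw [hP, h0, ENNReal.ofReal_zero, ENNReal.zero_div]
      rw [this]
      exact bot_le
    · set d : Fin (n + 1) → ℂ := fun i => P.coeff i with hd
      have hPd : ofCoeffs n d = P := ofCoeffs_coeff hPn
      have hd0 : d ≠ 0 := by
        intro h
        refine hP ?_
        rw [← hPd, h]
        simp [ofCoeffs]
      have hdn : (‖d‖ : ℂ)⁻¹ ≠ 0 := by simpa using hd0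
      have hmem : (‖d‖ : ℂ)⁻¹ • d ∈ Metric.sphere (0 : Fin (n + 1) → ℂ) 1 := by
        rw [mem_sphere_zero_iff_norm, norm_smul, norm_inv, Complex.norm_real, norm_norm,
          inv_mul_cancel₀ (norm_ne_zero_iff.mpr hd0)]
      rw [← hPd, ← ratio_C_mul z p n hdn, ← ofCoeffs_smul, hratio _ hmem, hratio _ hc]
      exact ENNReal.ofReal_le_ofReal (hmax hmem)

end Attained

/-! ### The boundary values of `ψ₀` near the upper tip, and the distance to the level curve. -/

section Geometry

open Complex (I)

/-- The parameter on the upper segment of `ψ₀(e^{iθ})`, for `0 < θ < π`. -/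
noncomputable def segParam (θ : ℝ) : ℝ := 2 * Real.sin θ * √(Real.sin θ / (2 * (1 + Real.cos θ)))

theorem exp_I_mul (θ : ℝ) : Complex.exp (I * θ) = Real.cos θ + Real.sin θ * I := by
  rw [mul_comm, Complex.exp_mul_I, Complex.ofReal_cos, Complex.ofReal_sin]

theorem one_add_cos_pos {θ : ℝ} (h : 0 < Real.sin θ) : 0 < 1 + Real.cos θ := by
  nlinarith [Real.sin_sq_add_cos_sq θ, Real.neg_one_le_cos θ, pow_pos h 2]

theorem exp_I_mul_add_one_ne_zero {θ : ℝ} (h : 0 < Real.sin θ) : Complex.exp (I * θ) + 1 ≠ 0 := by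
  intro h0
  have hre := congrArg Complex.re h0
  simp only [exp_I_mul, Complex.add_re, Complex.re_ofReal_mul, Complex.ofReal_re, Complex.I_re,
    Complex.one_re, Complex.zero_re] at hre
  linarith [one_add_cos_pos h]

theorem exp_sub_one_div {θ : ℝ} (h : 0 < Real.sin θ) :
    (Complex.exp (I * θ) - 1) / (Complex.exp (I * θ) + 1) =
      ((Real.sin θ / (1 + Real.cos θ) : ℝ) : ℂ) * I := by
  have hc := one_add_cos_pos h
  have hne := exp_I_mul_add_one_ne_zero h
  have hc' : ((1 + Real.cos θ : ℝ) : ℂ) ≠ 0 := by exact_mod_cast hc.ne'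
  have hsq : (Real.sin θ : ℂ) ^ 2 + (Real.cos θ : ℂ) ^ 2 = 1 := by
    exact_mod_cast Real.sin_sq_add_cos_sq θ
  rw [div_eq_iff hne, exp_I_mul, Complex.ofReal_div]
  rw [div_mul_eq_mul_div, div_mul_eq_mul_div, eq_div_iff hc']
  push_cast at hsq ⊢
  linear_combination hsq - Complex.sin θ ^ 2 * Complex.I_sq

theorem psi_exp_I_mul {θ : ℝ} (h : 0 < Real.sin θ) :
    psi (Complex.exp (I * θ)) = upperSeg (segParam θ) := by
  have hc := one_add_cos_pos h
  set τ := Real.sin θ / (2 * (1 + Real.cos θ)) with hτ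
  have hτ0 : 0 < τ := by positivity
  have hsq : (Real.sin θ : ℂ) ^ 2 + (Real.cos θ : ℂ) ^ 2 = 1 := by
    exact_mod_cast Real.sin_sq_add_cos_sq θ
  have hroot : (((Real.sin θ / (1 + Real.cos θ) : ℝ) : ℂ) * I) ^ (1 / 2 : ℂ) =
      (√τ : ℂ) * (1 + I) := by
    -- Both `±√τ (1 + i)` square to `2τ i`; the positive real part selects the principal root.
    have hre : 0 < ((√τ : ℂ) * (1 + I)).re := by
      rw [Complex.re_ofReal_mul]; simpa using hτ0
    rw [one_div, ← Complex.sq_cpow_two_inv hre]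
    congr 1
    have h1 : (√τ : ℂ) ^ 2 = ((τ : ℝ) : ℂ) := by
      rw [← Complex.ofReal_pow, Real.sq_sqrt hτ0.le]
    have h2 : Real.sin θ / (1 + Real.cos θ) = 2 * τ := by rw [hτ]; field_simp
    rw [mul_pow, h1, h2]
    push_cast
    linear_combination (-τ) * Complex.I_sq
  have hinv : 1 / Complex.exp (I * θ) = Real.cos θ - Real.sin θ * I := by
    rw [one_div, ← Complex.exp_neg]
    have : -(I * (θ : ℂ)) = I * ((-θ : ℝ) : ℂ) := by push_cast; ring
    rw [this, exp_I_mul, Real.cos_neg, Real.sin_neg]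
    push_cast; ring
  unfold psi upperSeg segParam
  rw [exp_sub_one_div h, hroot, hinv, exp_I_mul, ← hτ]
  push_cast
  linear_combination (2 * Complex.sin θ * (√τ : ℂ)) * Complex.I_sq

theorem segParam_nonneg {θ : ℝ} (h : 0 ≤ Real.sin θ) : 0 ≤ segParam θ := by
  unfold segParam; positivity

/-- Squaring turns the parameter into a trigonometric polynomial, for which comparisons near the tip
are exact identities. -/
theorem segParam_sq {θ : ℝ} (h : 0 < Real.sin θ) :
    segParam θ ^ 2 = 2 * Real.sin θ * (1 - Real.cos θ) := by
  have hc := one_add_cos_pos h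
  unfold segParam
  rw [mul_pow, Real.sq_sqrt (by positivity)]
  field_simp
  linear_combination Real.sin_sq_add_cos_sq θ

theorem halfLen_sq_sq : (halfLen ^ 2) ^ 2 = 27 / 4 := by
  have h2 : (√2) ^ 2 = 2 := Real.sq_sqrt two_pos.le
  have h27 : ((27 : ℝ) ^ (1 / 4 : ℝ)) ^ 4 = 27 := by
    rw [← Real.rpow_natCast, ← Real.rpow_mul (by norm_num)]; norm_num
  unfold halfLen
  rw [← pow_mul, div_pow, show 2 * 2 = 4 from rfl, h27, show (√2) ^ 4 = ((√2) ^ 2) ^ 2 by ring, h2]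
  norm_num

theorem segParam_mem_Icc {θ : ℝ} (h : 0 < Real.sin θ) : segParam θ ∈ Set.Icc 0 halfLen := by
  refine ⟨segParam_nonneg h.le, ?_⟩
  rw [← pow_le_pow_iff_left₀ (segParam_nonneg h.le) halfLen_pos.le two_ne_zero,
    ← pow_le_pow_iff_left₀ (by positivity) (by positivity) two_ne_zero, halfLen_sq_sq,
    segParam_sq h]
  set c := Real.cos θ
  have hs : Real.sin θ ^ 2 = 1 - c ^ 2 := by linear_combination Real.sin_sq_add_cos_sq θ
  have : (2 * Real.sin θ * (1 - c)) ^ 2 = 4 * (1 - c ^ 2) * (1 - c) ^ 2 := by rw [← hs]; ring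
  rw [this]
  -- The difference of the two sides is `(2c + 1)² (c² - 3c + 11/4)`, with a double zero at the tip
  -- `c = -1/2`.
  nlinarith [mul_nonneg (sq_nonneg (2 * c + 1)) (add_nonneg (sq_nonneg (c - 2))
    (zero_le_one' ℝ)), sq_nonneg ((2 * c + 1) * (2 * c - 5)), sq_nonneg (2 * c + 1)]

/-- The squares of the two parameters differ by exactly `-2 sin δ (1 - cos δ)`, which is cubic in
`δ`. Both parameters are at least `1` in this range, so dividing by their sum loses nothing. -/
theorem abs_segParam_sub_le {δ : ℝ} (h0 : 0 < δ) (h1 : δ ≤ Real.pi / 6) :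
    |segParam (2 * Real.pi / 3 + δ) - segParam (2 * Real.pi / 3 - δ)| ≤ δ ^ 3 := by
  have hpi := Real.pi_pos
  have one_le : ∀ θ, Real.pi / 2 ≤ θ → θ ≤ 5 * Real.pi / 6 → 0 < Real.sin θ ∧ 1 ≤ segParam θ := by
    intro θ hθ hθ'
    have hs : 1 / 2 ≤ Real.sin θ := by
      rw [← Real.sin_pi_div_six, ← Real.sin_pi_sub θ]
      exact Real.sin_le_sin_of_le_of_le_pi_div_two (by linarith) (by linarith) (by linarith)
    have hs0 : 0 < Real.sin θ := by linarith
    have hc : Real.cos θ ≤ 0 := Real.cos_nonpos_of_pi_div_two_le_of_le hθ (by linarith)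
    refine ⟨hs0, ?_⟩
    have := segParam_sq hs0
    have h := segParam_nonneg hs0.le
    nlinarith
  obtain ⟨hp, hp1⟩ := one_le (2 * Real.pi / 3 + δ) (by linarith) (by linarith)
  obtain ⟨hm, hm1⟩ := one_le (2 * Real.pi / 3 - δ) (by linarith) (by linarith)
  have h23 : 2 * Real.pi / 3 = Real.pi - Real.pi / 3 := by ring
  have hsin : Real.sin (2 * Real.pi / 3) = √3 / 2 := by
    rw [h23, Real.sin_pi_sub, Real.sin_pi_div_three]
  have hcos : Real.cos (2 * Real.pi / 3) = -(1 / 2) := by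
    rw [h23, Real.cos_pi_sub, Real.cos_pi_div_three]
  have hdiff : segParam (2 * Real.pi / 3 + δ) ^ 2 - segParam (2 * Real.pi / 3 - δ) ^ 2 =
      -(2 * Real.sin δ * (1 - Real.cos δ)) := by
    rw [segParam_sq hp, segParam_sq hm, Real.sin_add, Real.sin_sub, Real.cos_add, Real.cos_sub,
      hsin, hcos]
    have h3 : √3 ^ 2 = (3 : ℝ) := Real.sq_sqrt (by norm_num)
    linear_combination (Real.sin δ * Real.cos δ) * h3
  have hsδ : 0 ≤ Real.sin δ := Real.sin_nonneg_of_nonneg_of_le_pi h0.le (by linarith)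
  have hbound : |segParam (2 * Real.pi / 3 + δ) ^ 2 - segParam (2 * Real.pi / 3 - δ) ^ 2| ≤
      δ ^ 3 := by
    have h2 : 1 - Real.cos δ ≤ δ ^ 2 / 2 := by linarith [Real.one_sub_sq_div_two_le_cos (x := δ)]
    have h3 : 0 ≤ 1 - Real.cos δ := by linarith [Real.cos_le_one δ]
    rw [hdiff, abs_neg, abs_of_nonneg (by positivity)]
    calc 2 * Real.sin δ * (1 - Real.cos δ) ≤ 2 * δ * (δ ^ 2 / 2) := by
          gcongr
          exact Real.sin_le h0.le
      _ = δ ^ 3 := by ring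
  refine le_trans ?_ hbound
  rw [sq_sub_sq, abs_mul]
  refine le_mul_of_one_le_left (abs_nonneg _) (le_abs.mpr (Or.inl ?_))
  linarith

/-- The point of the unit circle that `ψ₀` maps to the tip of the upper segment. -/
noncomputable def tipPreimage : ℂ := Complex.exp (I * (2 * Real.pi / 3 : ℝ))

theorem sin_two_pi_div_three_pos : 0 < Real.sin (2 * Real.pi / 3) :=
  Real.sin_pos_of_pos_of_lt_pi (by positivity) (by linarith [Real.pi_pos])

theorem differentiableAt_psi_tipPreimage : DifferentiableAt ℂ psi tipPreimage := by
  have hs := sin_two_pi_div_three_pos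
  have hc := one_add_cos_pos hs
  have hne : tipPreimage ≠ 0 := Complex.exp_ne_zero _
  have hne1 : tipPreimage + 1 ≠ 0 := exp_I_mul_add_one_ne_zero hs
  have hslit : (tipPreimage - 1) / (tipPreimage + 1) ∈ Complex.slitPlane := by
    rw [tipPreimage, exp_sub_one_div hs, Complex.mem_slitPlane_iff]
    right
    rw [Complex.im_ofReal_mul, Complex.I_im, mul_one]
    positivity
  unfold psi
  refine DifferentiableAt.mul ?_ (DifferentiableAt.cpow_const ?_ hslit)
  · exact differentiableAt_id.sub ((differentiableAt_const _).div differentiableAt_id hne)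
  · exact (differentiableAt_id.sub_const _).div (differentiableAt_id.add_const _) hne1

theorem exists_norm_psi_sub_le : ∃ K > 0, ∃ r > 0, ∀ w : ℂ, ‖w - tipPreimage‖ < r →
    ‖psi w - psi tipPreimage‖ ≤ K * ‖w - tipPreimage‖ := by
  obtain ⟨K, hK, h⟩ := differentiableAt_psi_tipPreimage.hasDerivAt.isBigO_sub.exists_pos
  obtain ⟨r, hr, h⟩ := Metric.eventually_nhds_iff.mp h.bound
  exact ⟨K, hK, r, hr, fun w hw => h (by rwa [dist_eq_norm])⟩

theorem norm_exp_sub_tipPreimage_le (δ : ℝ) :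
    ‖Complex.exp (I * (2 * Real.pi / 3 + δ : ℝ)) - tipPreimage‖ ≤ |δ| := by
  have : Complex.exp (I * (2 * Real.pi / 3 + δ : ℝ)) - tipPreimage =
      tipPreimage * (Complex.exp (I * δ) - 1) := by
    rw [tipPreimage, mul_sub, ← Complex.exp_add, mul_one]
    congr 2
    push_cast
    ring
  rw [this, norm_mul, tipPreimage, mul_comm I, Complex.norm_exp_ofReal_mul_I, one_mul]
  exact Real.norm_exp_I_mul_ofReal_sub_one_le

/-- The distance to the level curve near the tip of the upper segment is `O(1/n)`. -/
theorem exists_infDist_levelCurve_le (a : ℝ) : ∃ K : ℝ, 0 < K ∧ ∀ᶠ n : ℕ in atTop, ∀ δ : ℝ,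
    |δ| ≤ a / ((n : ℝ) + 1) →
      Metric.infDist (psi (Complex.exp (I * (2 * Real.pi / 3 + δ : ℝ)))) (levelCurve n) ≤
        K / ((n : ℝ) + 1) := by
  obtain ⟨K, hK, r, hr, h⟩ := exists_norm_psi_sub_le
  refine ⟨K * (|a| + 1), by positivity, ?_⟩
  have hlim : Tendsto (fun n : ℕ => (|a| + 1) * (1 / ((n : ℝ) + 1))) atTop (nhds 0) := by
    simpa using tendsto_one_div_add_atTop_nhds_zero_nat.const_mul (|a| + 1)
  filter_upwards [hlim.eventually_lt_const hr] with n hn δ hδ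
  have hn0 : (0 : ℝ) < (n : ℝ) + 1 := by positivity
  set e : ℝ := 1 / ((n : ℝ) + 1) with he
  have he0 : 0 < e := by positivity
  have hδe : |δ| ≤ |a| * e := by
    refine hδ.trans ?_
    rw [he, mul_one_div]
    gcongr
    exact le_abs_self a
  set w := Complex.exp (I * (2 * Real.pi / 3 + δ : ℝ)) with hw
  have hwd : ‖w - tipPreimage‖ ≤ |a| * e := (norm_exp_sub_tipPreimage_le δ).trans hδe
  have htip : ‖tipPreimage‖ = 1 := by
    rw [tipPreimage, mul_comm, Complex.norm_exp_ofReal_mul_I]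
  set v := ((1 + e : ℝ) : ℂ) * tipPreimage with hv
  have hvd : ‖v - tipPreimage‖ = e := by
    have : v - tipPreimage = (e : ℂ) * tipPreimage := by rw [hv]; push_cast; ring
    rw [this, norm_mul, htip, Complex.norm_real, Real.norm_eq_abs, abs_of_pos he0, mul_one]
  have hmem : psi v ∈ levelCurve n := by
    refine ⟨v, ?_, rfl⟩
    rw [mem_sphere_zero_iff_norm, hv, norm_mul, htip, Complex.norm_real, Real.norm_eq_abs,
      abs_of_pos (by positivity), mul_one]
  have hae : 0 ≤ |a| * e := by positivity
  calc Metric.infDist (psi w) (levelCurve n) ≤ dist (psi w) (psi v) :=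
        Metric.infDist_le_dist_of_mem hmem
    _ ≤ ‖psi w - psi tipPreimage‖ + ‖psi v - psi tipPreimage‖ := by
        rw [dist_eq_norm, norm_sub_rev (psi v)]
        exact norm_sub_le_norm_sub_add_norm_sub _ _ _
    _ ≤ K * ‖w - tipPreimage‖ + K * ‖v - tipPreimage‖ := by
        refine add_le_add (h w (by nlinarith)) (h v (by nlinarith))
    _ ≤ K * (|a| * e) + K * e := by rw [hvd]; gcongr
    _ = K * (|a| + 1) / ((n : ℝ) + 1) := by rw [he]; ring

end Geometry

/-! ### The test polynomials and the divergence of the ratio. -/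

section Divergence

open Polynomial

/-- Here `s` is the twin node, where `P` vanishes, and `t` is the omitted node, which carries the
whole discrete sum with weight `d`. Markov's inequality with constant `B` bounds the value at `t`
from above and the integral from below by the same maximum, which cancels in `hVd`. -/
theorem mul_discMean_le_contMean {z : ℕ → ℕ → ℂ} {p : ℝ} (hp : 0 < p) {n : ℕ} (hn : 1 ≤ n)
    {P : ℂ[X]} (hP : P.natDegree ≤ n) {s t d V B : ℝ} (hs : s ∈ Set.Icc 0 halfLen)
    (ht : t ∈ Set.Icc 0 halfLen) (hPs : P.eval (upperSeg s) = 0)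
    (hdisc : discMean z p n P = ‖P.eval (upperSeg t)‖ ^ p * d) (hd : 0 ≤ d) (hV : 0 ≤ V)
    (hB : B = 2 / halfLen * Real.exp 3 * (n : ℝ) ^ 2)
    (hVd : V * (d * (2 * B) * (2 * B * |t - s|) ^ p) ≤ 1) :
    V * discMean z p n P ≤ contMean p P := by
  have hL := halfLen_pos
  have hn' : (1 : ℝ) ≤ n := by exact_mod_cast hn
  have hB0 : 0 < B := by rw [hB]; positivity
  set Q : ℂ[X] := P.comp (C (-1 + Complex.I) * X) with hQ
  have hQe : ∀ x : ℝ, Q.eval (x : ℂ) = P.eval (upperSeg x) := by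
    intro x
    simp [hQ, upperSeg]
  have hQn : Q.natDegree ≤ n := by
    refine natDegree_comp_le.trans ?_
    have : (C (-1 + Complex.I) * X).natDegree ≤ 1 := by
      simpa using natDegree_linear_le (a := -1 + Complex.I) (b := 0)
    nlinarith
  have hQc : Continuous fun x : ℝ => Q.eval (x : ℂ) := Q.continuous.comp Complex.continuous_ofReal
  obtain ⟨x₀, hx₀, hmax⟩ := isCompact_Icc.exists_isMaxOn (Set.nonempty_Icc.mpr hL.le)
    hQc.norm.continuousOn
  set M := ‖Q.eval (x₀ : ℂ)‖ with hM
  have hM0 : 0 ≤ M := norm_nonneg _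
  have hLip : ∀ x ∈ Set.Icc 0 halfLen, ∀ y ∈ Set.Icc 0 halfLen,
      ‖Q.eval (y : ℂ) - Q.eval (x : ℂ)‖ ≤ B * M * |y - x| := fun x hx y hy => by
    rw [hB]
    exact norm_eval_sub_le_of_Icc hn hQn hL (fun u hu => hmax hu) hx hy
  have hBL : 1 / (2 * B) ≤ halfLen / 2 := by
    have he : 1 ≤ Real.exp 3 := Real.one_le_exp (by norm_num)
    have h1 : 2 / halfLen ≤ B := by
      rw [hB, mul_assoc]
      refine le_mul_of_one_le_right (by positivity) ?_
      nlinarith [pow_le_pow_left₀ zero_le_one hn' 2]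
    rw [div_le_iff₀ hL] at h1
    rw [div_le_div_iff₀ (by positivity) two_pos]
    linarith
  have hint := le_intervalIntegral_norm_rpow hQc hp hB0 hBL hx₀ hM.symm
    fun x hx => hLip x₀ hx₀ x hx
  simp only [hQe] at hint
  refine le_trans ?_ (hint.trans (intervalIntegral_upperSeg_le_contMean p hp P))
  have hPt : ‖P.eval (upperSeg t)‖ ≤ (2 * B * |t - s|) * (M / 2) := by
    have := hLip s hs t ht
    rw [hQe, hQe, hPs, sub_zero] at this
    linarith
  calc V * discMean z p n P ≤ V * (((2 * B * |t - s|) * (M / 2)) ^ p * d) := by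
        rw [hdisc]; gcongr
    _ = V * (d * (2 * B) * (2 * B * |t - s|) ^ p) * (1 / (2 * B) * (M / 2) ^ p) := by
        rw [Real.mul_rpow (by positivity) (by positivity)]
        field_simp
    _ ≤ 1 * (1 / (2 * B) * (M / 2) ^ p) := by gcongr
    _ = _ := one_mul _

/-- The nodal polynomial of all nodes except the `k`-th. -/
noncomputable def nodalErase (z : ℕ → ℕ → ℂ) (n k : ℕ) : ℂ[X] :=
  ∏ i ∈ (Finset.range (n + 1)).erase k, (X - C (z n i))

theorem nodalErase_ne_zero (z : ℕ → ℕ → ℂ) (n k : ℕ) : nodalErase z n k ≠ 0 :=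
  (monic_prod_of_monic _ _ fun _ _ => monic_X_sub_C _).ne_zero

theorem natDegree_nodalErase (z : ℕ → ℕ → ℂ) {n k : ℕ} (hk : k ≤ n) :
    (nodalErase z n k).natDegree = n := by
  rw [nodalErase, natDegree_prod_of_monic _ _ fun _ _ => monic_X_sub_C _]
  simp [Finset.card_erase_of_mem (Finset.mem_range.mpr (Nat.lt_succ_of_le hk))]

theorem eval_nodalErase (z : ℕ → ℕ → ℂ) {n k i : ℕ} (hi : i ≤ n) (hik : i ≠ k) :
    (nodalErase z n k).eval (z n i) = 0 := by
  rw [nodalErase, eval_prod]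
  exact Finset.prod_eq_zero (Finset.mem_erase.mpr ⟨hik, Finset.mem_range.mpr (by omega)⟩) (by simp)

theorem discMean_nodalErase (z : ℕ → ℕ → ℂ) {p : ℝ} (hp : 0 < p) {n k : ℕ} (hk : k ≤ n) :
    discMean z p n (nodalErase z n k) =
      ‖(nodalErase z n k).eval (z n k)‖ ^ p * Metric.infDist (z n k) (levelCurve n) := by
  unfold discMean
  refine Finset.sum_eq_single_of_mem k (Finset.mem_range.mpr (by omega)) fun i hi hik => ?_
  rw [eval_nodalErase z (by simpa [Nat.lt_succ_iff] using hi) hik, norm_zero,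
    Real.zero_rpow hp.ne', zero_mul]

/-- With `n + 1 = 3 (2m + 1)`, the index `2m + 1` has angle exactly `2π/3`. -/
theorem angle_before_tip (m : ℕ) :
    angle (6 * m + 2) (2 * m) = 2 * Real.pi / 3 - 2 * Real.pi / ((6 * m + 2 : ℕ) + 1) := by
  rw [angle, if_pos (by omega), upperAngle, if_pos ⟨3 * m + 1, by ring⟩]
  push_cast
  have : (6 * (m : ℝ) + 2 + 1) ≠ 0 := by positivity
  field_simp
  ring

theorem angle_after_tip {m : ℕ} (hm : 1 ≤ m) :
    angle (6 * m + 2) (2 * m + 2) = 2 * Real.pi / 3 + 2 * Real.pi / ((6 * m + 2 : ℕ) + 1) := by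
  rw [angle, if_pos (by omega), upperAngle, if_pos ⟨3 * m + 1, by ring⟩]
  push_cast
  have : (6 * (m : ℝ) + 2 + 1) ≠ 0 := by positivity
  field_simp
  ring

/-- The expression is a multiple of `x^{1-p}`; this is where `p > 1` enters. -/
theorem tendsto_mul_rpow_atTop_nhds_zero {p : ℝ} (hp : 1 < p) (a : ℝ) {c : ℝ} (hc : 0 ≤ c) :
    Tendsto (fun x : ℝ => a * x * (c / x) ^ p) atTop (nhds 0) := by
  have h := (tendsto_rpow_neg_atTop (sub_pos.mpr hp)).const_mul (a * c ^ p)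
  rw [mul_zero] at h
  refine h.congr' ?_
  filter_upwards [eventually_gt_atTop 0] with x hx
  rw [Real.div_rpow hc hx.le, neg_sub, Real.rpow_sub hx, Real.rpow_one]
  ring

theorem tendsto_six_mul_add_two : Tendsto (fun m : ℕ => 6 * m + 2) atTop atTop :=
  tendsto_atTop_mono (fun m => (by omega : m ≤ 6 * m + 2)) tendsto_id

theorem eventually_ofReal_le_supRatio {p : ℝ} (hp : 1 < p) {V : ℝ} (hV : 0 ≤ V) :
    ∀ᶠ m : ℕ in atTop, ENNReal.ofReal V ≤ supRatio fejer p (6 * m + 2) := by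
  have hp0 : 0 < p := by linarith
  have hpi := Real.pi_pos
  have hL := halfLen_pos
  obtain ⟨K, hK, hdist⟩ := exists_infDist_levelCurve_le (2 * Real.pi)
  have hsub := tendsto_six_mul_add_two
  have hcast : Tendsto (fun m : ℕ => (((6 * m + 2 : ℕ) : ℝ) + 1)) atTop atTop :=
    tendsto_atTop_add_const_right _ _ (tendsto_natCast_atTop_atTop.comp hsub)
  set b : ℝ := 2 / halfLen * Real.exp 3 with hb
  have hb0 : 0 < b := by positivity
  have hlim := ((tendsto_mul_rpow_atTop_nhds_zero hp (2 * K * b)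
    (c := 2 * b * (2 * Real.pi) ^ 3) (by positivity)).comp hcast).const_mul V
  rw [mul_zero] at hlim
  filter_upwards [hsub.eventually hdist, hlim.eventually_le_const one_pos,
    -- From `m ≥ 2` follows `n + 1 ≥ 12`, hence `δ ≤ π/6`.
    eventually_ge_atTop 2] with m hdm hVm hm
  set n := 6 * m + 2 with hn
  set N : ℝ := (n : ℝ) + 1 with hN
  have hN12 : 12 ≤ N := by
    have : (14 : ℝ) ≤ n := by exact_mod_cast (by omega : 14 ≤ n)
    linarith
  have hN0 : 0 < N := by linarith
  set δ : ℝ := 2 * Real.pi / N with hδ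
  have hδ0 : 0 < δ := by positivity
  have hδ6 : δ ≤ Real.pi / 6 := by
    rw [hδ, div_le_div_iff₀ hN0 (by norm_num)]
    nlinarith
  have hsin_plus : 0 < Real.sin (2 * Real.pi / 3 + δ) :=
    Real.sin_pos_of_pos_of_lt_pi (by positivity) (by linarith)
  have hsin_minus : 0 < Real.sin (2 * Real.pi / 3 - δ) :=
    Real.sin_pos_of_pos_of_lt_pi (by linarith) (by linarith)
  have hz_minus : fejer n (2 * m) = upperSeg (segParam (2 * Real.pi / 3 - δ)) := by
    rw [fejer, hn, angle_before_tip, psi_exp_I_mul hsin_minus]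
  have hz_plus : fejer n (2 * m + 2) = upperSeg (segParam (2 * Real.pi / 3 + δ)) := by
    rw [fejer, hn, angle_after_tip (by omega), psi_exp_I_mul hsin_plus]
  have hkn : 2 * m + 2 ≤ n := by omega
  set P := nodalErase fejer n (2 * m + 2) with hP
  set d := Metric.infDist (fejer n (2 * m + 2)) (levelCurve n) with hd
  have hd0 : 0 ≤ d := Metric.infDist_nonneg
  have hdK : d ≤ K / N := by
    have := hdm δ (by rw [abs_of_pos hδ0])
    rwa [psi_exp_I_mul hsin_plus, ← hz_plus] at this
  have hgap := abs_segParam_sub_le hδ0 hδ6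
  set B := b * (n : ℝ) ^ 2 with hB
  have hB0 : 0 ≤ B := by positivity
  have hBN : B ≤ b * N ^ 2 := by
    rw [hB]
    gcongr
    linarith
  have hle : V * discMean fejer p n P ≤ contMean p P := by
    refine mul_discMean_le_contMean hp0 (by omega) (natDegree_nodalErase fejer hkn).le
      (segParam_mem_Icc hsin_minus) (segParam_mem_Icc hsin_plus) ?_ ?_ hd0 hV hB ?_
    · rw [← hz_minus]
      exact eval_nodalErase fejer (by omega) (by omega)
    · rw [← hz_plus]
      exact discMean_nodalErase fejer hp0 hkn
    · refine le_trans ?_ hVm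
      simp only [Function.comp_apply]
      -- Orders of magnitude: weight `N⁻¹`, Markov factor `N²`, gap `N⁻³`, in total `N · N^{-p}`.
      calc _ ≤ V * (K / N * (2 * (b * N ^ 2)) * (2 * (b * N ^ 2) * δ ^ 3) ^ p) := by gcongr
        _ = V * (2 * K * b * N * (2 * b * (2 * Real.pi) ^ 3 / N) ^ p) := by
            congr 2
            · field_simp
            · congr 1
              rw [hδ]
              field_simp
  refine le_trans ?_ (ratio_le_supRatio fejer p (natDegree_nodalErase fejer hkn).le)
  have hpos := contMean_pos hp0 (nodalErase_ne_zero fejer n (2 * m + 2))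
  unfold ratio
  rw [ENNReal.le_div_iff_mul_le (Or.inr (ENNReal.ofReal_pos.mpr hpos).ne')
    (Or.inl ENNReal.ofReal_ne_top), ← ENNReal.ofReal_mul hV]
  exact ENNReal.ofReal_le_ofReal hle

theorem limsup_supRatio_fejer {p : ℝ} (hp : 1 < p) :
    limsup (fun n : ℕ => supRatio fejer p n) atTop = ⊤ := by
  have hsub := tendsto_six_mul_add_two
  refine ENNReal.eq_top_of_forall_nnreal_le fun V => le_limsup_of_frequently_le' ?_
  refine hsub.frequently (Eventually.frequently ?_)
  simpa using eventually_ofReal_le_supRatio hp V.2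

theorem ModifiedMZ.exists_supRatio_le {z : ℕ → ℕ → ℂ} {p : ℝ} (h : ModifiedMZ z p) :
    ∃ c : ℝ, ∀ n : ℕ, 1 ≤ n → supRatio z p n ≤ ENNReal.ofReal c := by
  obtain ⟨c₁, c₂, h1, h12, h⟩ := h
  refine ⟨c₂, fun n hn => iSup₂_le fun P hP => ?_⟩
  refine ENNReal.div_le_of_le_mul ?_
  rw [← ENNReal.ofReal_mul (h1.le.trans h12)]
  exact ENNReal.ofReal_le_ofReal (h n hn P hP).2

theorem not_modifiedMZ_fejer {p : ℝ} (hp : 1 < p) : ¬ ModifiedMZ fejer p := by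
  intro h
  obtain ⟨c, hc⟩ := h.exists_supRatio_le
  have hle : limsup (fun n : ℕ => supRatio fejer p n) atTop ≤ ENNReal.ofReal c :=
    limsup_le_of_le (h := eventually_atTop.mpr ⟨1, hc⟩)
  rw [limsup_supRatio_fejer hp, top_le_iff] at hle
  exact ENNReal.ofReal_ne_top hle

end Divergence

end LArc

/-- For every `n` the supremum of the ratio over `Πₙ` is a maximum, the upper limit of these
maxima is `∞`, and so the modified Marcinkiewicz–Zygmund inequalities fail. -/
theorem theorem2 (p : ℝ) (hp : 1 < p) :
    (∀ n : ℕ, ∃ P : Polynomial ℂ, P ≠ 0 ∧ P.natDegree ≤ n ∧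
      LArc.ratio LArc.fejer p n P = LArc.supRatio LArc.fejer p n) ∧
    Filter.limsup (fun n : ℕ => LArc.supRatio LArc.fejer p n) Filter.atTop = ⊤ ∧
    ¬ LArc.ModifiedMZ LArc.fejer p :=
  ⟨LArc.exists_ratio_eq_supRatio LArc.fejer (zero_lt_one.trans hp),
    LArc.limsup_supRatio_fejer hp, LArc.not_modifiedMZ_fejer hp⟩
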